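/- Let $\mathcal L_s(\mathbb C)$ be the space of formal semi-Laurent series $\sum_{n\ge N}g_nz^n$ ($N\in\mathbb Z$) with complex coefficients, $\mathbb X(\mathbb C)\subset\mathcal L_s(\mathbb C)$ the formal power series, and $z\mathbb X(\mathbb C)$ the power series without constant term. Let $$RL_1(\mathbb C)=\{(g,f): g\in\mathcal L_s(\mathbb C),\ g\ne 0,\ f\in\mathbb X(\mathbb C),\ \operatorname{ord} f=1\},\qquad (g,f)*(h,k)=(g\cdot(h\circ f),\,k\circ f),$$ a group with identity $(1,z)$. Identify $(\gamma,\kappa)\in\mathcal L_s(\mathbb C)\times z\mathbb X(\mathbb C)$ with its coefficients $((\gamma_n)_{n\in\mathbb Z},(\kappa_n)_{n\ge1})\in s_L\times s$, where $s$ is the space of complex sequences and $s_L$ the space of two-sided complex sequences vanishing for all sufficiently small indices, both with the topology of pointwise convergence. Then $RL_1(\mathbb C)$ is an open subset of $s_L\times s$. For $F:RL_1(\mathbb C)\to \mathcal L_s(\mathbb C)\times z\mathbb X(\mathbb C)$ write $d_vF(a)=\lim_{t\to0}t^{-1}(F(a+tv)-F(a))$ ($t\in\mathbb C$), whenever the limit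 exists in this topology. A vector field is a map $X:RL_1(\mathbb C)\to\mathcal L_s(\mathbb C)\times z\mathbb X(\mathbb C)$. It is left-invariant if for all $a,b\in RL_1(\mathbb C)$ the directional derivative at $b$, in the direction $X(b)$, of the left translation $c\mapsto a*c$ exists and equals $X(a*b)$. The bracket of two vector fields is $[X,Y](a)=d_{X(a)}Y(a)-d_{Y(a)}X(a)$, if these derivatives exist for all $a$. Proposition (Lie algebra $rl_1(\mathbb C)$). The tangent space of $RL_1(\mathbb C)$ at each point (the set of velocities of curves through that point) is $\mathcal L_s(\mathbb C)\times z\mathbb X(\mathbb C)$. The left-invariant vector fields form a complex vector space, and $X\mapsto X(1,z)$ is a linear isomorphism from it onto $\mathcal L_s(\mathbb C)\times z\mathbb X(\mathbb C)$. The bracket of any two left-invariant vector fields exists and is left-invariant. Under this isomorphism it makes $\mathcal L_s(\mathbb C)\times z\mathbb X(\mathbb C)$ a complex Lie algebra (the bracket is bilinear, alternating, and satisfies the Jacobi identity), and it is given by $$[(\gamma_1,\kappa_1),(\gamma_2,\kappa_2)]=(\gamma_2'\kappa_1-\gamma_1'\kappa_2,\ \kappa_2'\kappa_1-\kappa_1'\kappa_2).$$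 -/

import Mathlib

open Filter Topology
open scoped PowerSeries LaurentSeries

namespace RiordanLie

theorem ord_one_data {f : ℂ⟦X⟧} (hf : f.order = 1) :
    PowerSeries.constantCoeff f = 0 ∧ PowerSeries.coeff 1 f ≠ 0 := by
  have h := (PowerSeries.order_eq_nat (φ := f) (n := 1)).1 (by simpa using hf)
  refine ⟨?_, h.1⟩
  have := h.2 0 (by norm_num)
  simpa using this

theorem order_eq_one_iff (f : ℂ⟦X⟧) :
    f.order = 1 ↔ PowerSeries.constantCoeff f = 0 ∧ PowerSeries.coeff 1 f ≠ 0 := by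
  refine ⟨ord_one_data, fun h => ?_⟩
  have := (PowerSeries.order_eq_nat (φ := f) (n := 1)).2 ⟨h.2, fun i hi => by
    obtain rfl : i = 0 := by omega
    simpa using h.1⟩
  simpa using this

/-- The composition `g ∘ f`: its `k`-th coefficient is `∑ n, g_n [z^k] (f ^ n)`.  For a power
series `f` without constant term this sum is finite and the coefficients vanish for `k` small
enough, so that the fallback value is not used. -/
noncomputable def laurentComp (g : ℂ⸨X⸩) (f : ℂ⟦X⟧) : ℂ⸨X⸩ :=
  open Classical in
  if h : BddBelow (Function.support
      (fun k : ℤ => ∑ᶠ n : ℤ, g.coeff n * ((f : ℂ⸨X⸩) ^ n).coeff k)) then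
    HahnSeries.ofSuppBddBelow _ h
  else 0

theorem coe_zpow_eq {f : ℂ⟦X⟧} (hf : f.order = 1) (n : ℤ) :
    ∃ w : ℂ⟦X⟧, (f : ℂ⸨X⸩) ^ n = HahnSeries.single n 1 * (w : ℂ⸨X⸩) := by
  have h := PowerSeries.X_pow_order_mul_divXPowOrder (f := f)
  set u := f.divXPowOrder with hu
  have h1 : f.order.toNat = 1 := by simp [hf]
  rw [h1, pow_one] at h
  have hu0 : PowerSeries.constantCoeff u ≠ 0 := by
    intro h0
    apply (ord_one_data hf).2
    rw [← h, ← zero_add 1, PowerSeries.coeff_succ_X_mul]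
    simpa using h0
  have hunit : IsUnit u := PowerSeries.isUnit_iff_constantCoeff.2 (isUnit_iff_ne_zero.2 hu0)
  obtain ⟨v, hv⟩ := hunit
  refine ⟨((v ^ n : ℂ⟦X⟧ˣ) : ℂ⟦X⟧), ?_⟩
  have h2 : (f : ℂ⸨X⸩) = HahnSeries.single (1 : ℤ) 1 * ((v : ℂ⟦X⟧) : ℂ⸨X⸩) := by
    rw [← h, hv, map_mul, HahnSeries.ofPowerSeries_X]
  rw [h2, mul_zpow, ← RatFunc.single_zpow]
  congr 1
  have h3 := map_zpow (Units.map (HahnSeries.ofPowerSeries ℤ ℂ).toMonoidHom) v n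
  have h4 := congrArg (Units.val) h3
  rw [Units.val_zpow_eq_zpow_val] at h4
  exact h4.symm

theorem coeff_single_mul_coe (n k : ℤ) (w : ℂ⟦X⟧) :
    (HahnSeries.single n (1 : ℂ) * (w : ℂ⸨X⸩)).coeff k =
      if n ≤ k then PowerSeries.coeff (k - n).toNat w else 0 := by
  have : k = (k - n) + n := by ring
  rw [this, HahnSeries.coeff_single_mul_add, one_mul, PowerSeries.coeff_coe]
  have e : (k - n + n - n) = k - n := by ring
  rw [e]
  split_ifs with h1 h2 h2
  · omega
  · rfl
  · congr 2; omega
  · omega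

theorem coeff_coe_zpow_of_lt {f : ℂ⟦X⟧} (hf : f.order = 1) {n k : ℤ} (h : k < n) :
    ((f : ℂ⸨X⸩) ^ n).coeff k = 0 := by
  obtain ⟨w, hw⟩ := coe_zpow_eq hf n
  rw [hw, coeff_single_mul_coe, if_neg (by omega)]

theorem hasSubst_of_order {f : ℂ⟦X⟧} (hf : f.order = 1) : PowerSeries.HasSubst f :=
  PowerSeries.HasSubst.of_constantCoeff_zero' (ord_one_data hf).1

theorem coe_ne_zero {f : ℂ⟦X⟧} (hf : f.order = 1) : (f : ℂ⸨X⸩) ≠ 0 := by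
  intro h
  have : f = 0 := HahnSeries.ofPowerSeries_injective (Γ := ℤ) (R := ℂ) (by rw [h, map_zero])
  rw [this] at hf
  simp at hf

theorem coeff_zpow_mul_subst {f : ℂ⟦X⟧} (hf : f.order = 1) (m : ℤ) (t : ℂ⟦X⟧) (k : ℤ) :
    ∑ᶠ n : ℤ, (HahnSeries.single m (1 : ℂ) * (t : ℂ⸨X⸩)).coeff n * ((f : ℂ⸨X⸩) ^ n).coeff k =
      ((f : ℂ⸨X⸩) ^ m * ((t.subst f : ℂ⟦X⟧) : ℂ⸨X⸩)).coeff k := by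
  set N : ℕ := (k - m + 1).toNat with hN
  have hs := hasSubst_of_order hf
  have ht : (t.subst f : ℂ⟦X⟧) = f ^ N * ((PowerSeries.mk fun i => PowerSeries.coeff (i + N) t).subst f)
      + ∑ i ∈ Finset.range N, PowerSeries.coeff i t • f ^ i := by
    conv_lhs => rw [PowerSeries.eq_X_pow_mul_shift_add_trunc N t]
    rw [PowerSeries.subst_add hs, PowerSeries.subst_mul hs, PowerSeries.subst_pow hs,
      PowerSeries.subst_X hs, PowerSeries.subst_coe hs]
    congr 1
    rw [PowerSeries.trunc_apply, map_sum, Nat.Ico_zero_eq_range]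
    refine Finset.sum_congr rfl fun i _ => ?_
    rw [Polynomial.aeval_monomial, Algebra.smul_def]
  have h0 : (f : ℂ⸨X⸩) ≠ 0 := coe_ne_zero hf
  rw [ht, map_add, mul_add, map_mul, map_pow, ← mul_assoc, ← zpow_natCast, ← zpow_add₀ h0,
    HahnSeries.coeff_add]
  have hz : ((f : ℂ⸨X⸩) ^ (m + N) * (((PowerSeries.mk fun i => PowerSeries.coeff (i + N) t).subst f
      : ℂ⟦X⟧) : ℂ⸨X⸩)).coeff k = 0 := by
    obtain ⟨w, hw⟩ := coe_zpow_eq hf (m + N)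
    rw [hw, mul_assoc, ← map_mul, coeff_single_mul_coe, if_neg (by omega)]
  rw [hz, zero_add, map_sum, Finset.mul_sum, HahnSeries.coeff_sum]
  rw [finsum_eq_sum_of_support_subset (s := (Finset.range N).image (fun i : ℕ => m + (i : ℤ)))]
  · rw [Finset.sum_image (by intro a _ b _ h; simpa using h)]
    refine Finset.sum_congr rfl fun i _ => ?_
    rw [coeff_single_mul_coe, if_pos (by omega), zpow_add₀ h0, zpow_natCast, PowerSeries.smul_eq_C_mul,
      map_mul, map_pow, PowerSeries.coe_C, mul_left_comm, HahnSeries.C_mul_eq_smul,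
      HahnSeries.coeff_smul, smul_eq_mul]
    congr 3
    omega
  · intro n hn
    rw [Function.mem_support] at hn
    have h1 : m ≤ n := by
      by_contra h
      apply hn
      rw [coeff_single_mul_coe, if_neg h, zero_mul]
    have h2 : n ≤ k := by
      by_contra h
      apply hn
      rw [coeff_coe_zpow_of_lt hf (by omega), mul_zero]
    simp only [Finset.coe_image, Set.mem_image, Finset.mem_coe, Finset.mem_range]
    exact ⟨(n - m).toNat, by omega, by omega⟩

theorem laurentComp_single_mul {f : ℂ⟦X⟧} (hf : f.order = 1) (m : ℤ) (t : ℂ⟦X⟧) :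
    laurentComp (HahnSeries.single m (1 : ℂ) * (t : ℂ⸨X⸩)) f =
      (f : ℂ⸨X⸩) ^ m * ((t.subst f : ℂ⟦X⟧) : ℂ⸨X⸩) := by
  have h : (fun k : ℤ => ∑ᶠ n : ℤ, (HahnSeries.single m (1 : ℂ) * (t : ℂ⸨X⸩)).coeff n *
      ((f : ℂ⸨X⸩) ^ n).coeff k) = ((f : ℂ⸨X⸩) ^ m * ((t.subst f : ℂ⟦X⟧) : ℂ⸨X⸩)).coeff :=
    funext fun k => coeff_zpow_mul_subst hf m t k
  have hb : BddBelow (Function.support (fun k : ℤ => ∑ᶠ n : ℤ,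
      (HahnSeries.single m (1 : ℂ) * (t : ℂ⸨X⸩)).coeff n * ((f : ℂ⸨X⸩) ^ n).coeff k)) := by
    rw [h]
    obtain ⟨w, hw⟩ := coe_zpow_eq hf m
    refine ⟨m, fun k hk => ?_⟩
    by_contra hlt
    apply hk
    rw [hw, mul_assoc, ← map_mul, coeff_single_mul_coe, if_neg hlt]
  rw [laurentComp, dif_pos hb]
  ext k
  exact congrFun h k

theorem laurentComp_coe {f : ℂ⟦X⟧} (hf : f.order = 1) (t : ℂ⟦X⟧) :
    laurentComp (t : ℂ⸨X⸩) f = ((t.subst f : ℂ⟦X⟧) : ℂ⸨X⸩) := by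
  have := laurentComp_single_mul hf 0 t
  rwa [zpow_zero, one_mul, ← HahnSeries.C_apply, HahnSeries.C_one, one_mul] at this

theorem laurentComp_mul {f : ℂ⟦X⟧} (hf : f.order = 1) (g h : ℂ⸨X⸩) :
    laurentComp (g * h) f = laurentComp g f * laurentComp h f := by
  rw [← g.single_order_mul_powerSeriesPart, ← h.single_order_mul_powerSeriesPart,
    laurentComp_single_mul hf, laurentComp_single_mul hf, mul_mul_mul_comm,
    HahnSeries.single_mul_single, one_mul, ← map_mul, laurentComp_single_mul hf,
    PowerSeries.subst_mul (hasSubst_of_order hf), zpow_add₀ (coe_ne_zero hf), map_mul]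
  ring

theorem laurentComp_one {f : ℂ⟦X⟧} (hf : f.order = 1) : laurentComp 1 f = 1 := by
  have h := laurentComp_coe hf 1
  rw [map_one] at h
  rw [h, ← PowerSeries.coe_substAlgHom (hasSubst_of_order hf), map_one, map_one]

theorem laurentComp_zero {f : ℂ⟦X⟧} (hf : f.order = 1) : laurentComp 0 f = 0 := by
  have h := laurentComp_coe hf 0
  rw [map_zero] at h
  rw [h, ← PowerSeries.coe_substAlgHom (hasSubst_of_order hf), map_zero, map_zero]

theorem laurentComp_ne_zero {f : ℂ⟦X⟧} (hf : f.order = 1) {g : ℂ⸨X⸩} (hg : g ≠ 0) :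
    laurentComp g f ≠ 0 := by
  intro h
  have := laurentComp_mul hf g g⁻¹
  rw [mul_inv_cancel₀ hg, laurentComp_one hf, h, zero_mul] at this
  exact one_ne_zero this

theorem order_subst {f k : ℂ⟦X⟧} (hf : f.order = 1) (hk : k.order = 1) :
    PowerSeries.order (k.subst f : ℂ⟦X⟧) = 1 := by
  have h := PowerSeries.X_pow_order_mul_divXPowOrder (f := k)
  have h1 : k.order.toNat = 1 := by simp [hk]
  rw [h1, pow_one] at h
  have hs := hasSubst_of_order hf
  have h2 : (k.subst f : ℂ⟦X⟧) = f * (k.divXPowOrder.subst f) := by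
    conv_lhs => rw [← h]
    rw [PowerSeries.subst_mul hs, PowerSeries.subst_X hs]
  have hu : IsUnit k.divXPowOrder := by
    rw [PowerSeries.isUnit_iff_constantCoeff, isUnit_iff_ne_zero]
    intro h0
    apply (ord_one_data hk).2
    rw [← h, ← zero_add 1, PowerSeries.coeff_succ_X_mul, PowerSeries.coeff_zero_eq_constantCoeff_apply, h0]
  have hv : IsUnit (k.divXPowOrder.subst f : ℂ⟦X⟧) := by
    rw [← PowerSeries.coe_substAlgHom hs]
    exact hu.map _
  rw [h2, PowerSeries.order_mul, hf, PowerSeries.order_zero_of_unit hv, add_zero]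

theorem laurentComp_comp {f k : ℂ⟦X⟧} (hf : f.order = 1) (hk : k.order = 1) (g : ℂ⸨X⸩) :
    laurentComp (laurentComp g k) f = laurentComp g (k.subst f) := by
  let φ : ℂ⸨X⸩ →*₀ ℂ⸨X⸩ :=
    { toFun := fun g => laurentComp g f
      map_zero' := laurentComp_zero hf
      map_one' := laurentComp_one hf
      map_mul' := laurentComp_mul hf }
  rw [← g.single_order_mul_powerSeriesPart, laurentComp_single_mul hk,
    laurentComp_single_mul (order_subst hf hk), laurentComp_mul hf, laurentComp_coe hf,
    PowerSeries.subst_comp_subst_apply (hasSubst_of_order hk) (hasSubst_of_order hf)]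
  congr 1
  have := map_zpow₀ φ (k : ℂ⸨X⸩) g.order
  change laurentComp _ f = (laurentComp _ f) ^ _ at this
  rw [this, laurentComp_coe hf]

theorem laurentComp_X (g : ℂ⸨X⸩) : laurentComp g PowerSeries.X = g := by
  conv_rhs => rw [← g.single_order_mul_powerSeriesPart]
  conv_lhs => rw [← g.single_order_mul_powerSeriesPart]
  rw [laurentComp_single_mul PowerSeries.order_X, PowerSeries.X_subst,
    HahnSeries.ofPowerSeries_X, ← RatFunc.single_zpow]

/-- The set of generalized Riordan arrays `(g, f)`, with `g ≠ 0` a formal semi-Laurent series and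
`f` a formal power series of order one. -/
@[ext]
structure RL where
  g : ℂ⸨X⸩
  f : ℂ⟦X⟧
  g_ne : g ≠ 0
  f_ord : f.order = 1

namespace RL

noncomputable instance : Mul RL :=
  ⟨fun a b => ⟨a.g * laurentComp b.g a.f, b.f.subst a.f,
    mul_ne_zero a.g_ne (laurentComp_ne_zero a.f_ord b.g_ne), order_subst a.f_ord b.f_ord⟩⟩

noncomputable instance : One RL := ⟨⟨1, PowerSeries.X, one_ne_zero, PowerSeries.order_X⟩⟩

/-- The compositional inverse. -/
noncomputable def compInv (a : RL) : ℂ⟦X⟧ :=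
  a.f.substInvOfIsUnit (isUnit_iff_ne_zero.2 (ord_one_data a.f_ord).2)

theorem compInv_ord (a : RL) : a.compInv.order = 1 := by
  rw [order_eq_one_iff]
  simp [compInv, (ord_one_data a.f_ord).2]

noncomputable instance : Inv RL :=
  ⟨fun a => ⟨laurentComp a.g⁻¹ a.compInv, a.compInv,
    laurentComp_ne_zero a.compInv_ord (inv_ne_zero a.g_ne), a.compInv_ord⟩⟩

theorem mul_g (a b : RL) : (a * b).g = a.g * laurentComp b.g a.f := rfl
theorem mul_f (a b : RL) : (a * b).f = b.f.subst a.f := rfl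
theorem one_g : (1 : RL).g = 1 := rfl
theorem one_f : (1 : RL).f = PowerSeries.X := rfl
theorem inv_g (a : RL) : a⁻¹.g = laurentComp a.g⁻¹ a.compInv := rfl
theorem inv_f (a : RL) : a⁻¹.f = a.compInv := rfl

noncomputable instance : Group RL :=
  Group.ofLeftAxioms
    (by
      intro a b c
      ext1
      · rw [mul_g, mul_g, mul_g, mul_g, mul_f, laurentComp_mul a.f_ord,
          laurentComp_comp a.f_ord b.f_ord, mul_assoc]
      · rw [mul_f, mul_f, mul_f, mul_f,
          PowerSeries.subst_comp_subst_apply (hasSubst_of_order b.f_ord)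
            (hasSubst_of_order a.f_ord)])
    (by
      intro a
      ext1
      · rw [mul_g, one_g, one_f, laurentComp_X, one_mul]
      · rw [mul_f, one_f, PowerSeries.X_subst])
    (by
      intro a
      ext1
      · rw [mul_g, inv_g, inv_f, ← laurentComp_mul a.compInv_ord, inv_mul_cancel₀ a.g_ne,
          laurentComp_one a.compInv_ord, one_g]
      · rw [mul_f, inv_f, one_f]
        exact PowerSeries.subst_substInvOfIsUnit_right _ (ord_one_data a.f_ord).1 _)

/-- The space `s_L` of two-sided complex sequences that vanish for all sufficiently small indices,
with the topology of pointwise convergence (the subspace topology of the product topology). -/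
def SL : Submodule ℂ (ℤ → ℂ) where
  carrier := {a | ∃ N : ℤ, ∀ n < N, a n = 0}
  zero_mem' := ⟨0, fun _ _ => rfl⟩
  add_mem' := by
    rintro a b ⟨N, hN⟩ ⟨M, hM⟩
    exact ⟨min N M, fun n hn => by simp [hN n (by omega), hM n (by omega)]⟩
  smul_mem' := by
    rintro c a ⟨N, hN⟩
    exact ⟨N, fun n hn => by simp [hN n hn]⟩

/-- The space `z 𝕏(ℂ)` of formal power series without constant term. -/
noncomputable def ZX : Submodule ℂ ℂ⟦X⟧ := LinearMap.ker (PowerSeries.coeff (R := ℂ) 0)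

/-- The vector space `𝓛_s(ℂ) × z 𝕏(ℂ)`. -/
abbrev Tan : Type := ℂ⸨X⸩ × ZX

/-- The identification of a pair of series with its coefficients
`((γ_n)_{n ∈ ℤ}, (κ_1, κ_2, …))` in `s_L × s`. -/
noncomputable def coords : Tan ≃ₗ[ℂ] SL × (ℕ → ℂ) where
  toFun v := (⟨v.1.coeff, v.1.order, fun _ hn => HahnSeries.coeff_eq_zero_of_lt_order hn⟩,
    fun n => PowerSeries.coeff (n + 1) (v.2 : ℂ⟦X⟧))
  invFun y := (HahnSeries.ofSuppBddBelow y.1.1 (by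
      obtain ⟨N, hN⟩ := y.1.2
      exact ⟨N, fun n hn => not_lt.1 fun h => hn (hN n h)⟩),
    ⟨PowerSeries.mk fun n => n.casesOn 0 y.2, by simp [ZX]⟩)
  map_add' v w := by
    ext <;> simp
  map_smul' c v := by
    ext <;> simp
  left_inv v := by
    obtain ⟨γ, κ, hκ⟩ := v
    refine Prod.ext (HahnSeries.ext rfl) (Subtype.ext (PowerSeries.ext fun n => ?_))
    cases n with
    | zero => simpa [ZX] using (LinearMap.mem_ker.1 hκ).symm
    | succ n => simp
  right_inv y := by
    ext <;> simp

/-- The pair `(g, f)` as an element of `𝓛_s(ℂ) × z 𝕏(ℂ)`; composed with `coords` this is the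
global chart of `RL`. -/
def toTan (a : RL) : Tan := (a.g, ⟨a.f, by
  simpa [ZX] using (ord_one_data a.f_ord).1⟩)

theorem toTan_injective : Function.Injective toTan := by
  intro a b h
  ext1
  · exact congrArg Prod.fst h
  · exact congrArg (fun v : Tan => (v.2 : ℂ⟦X⟧)) h

theorem range_toTan : Set.range toTan =
    {v : Tan | v.1 ≠ 0 ∧ PowerSeries.order (v.2 : ℂ⟦X⟧) = 1} := by
  ext v
  constructor
  · rintro ⟨a, rfl⟩
    exact ⟨a.g_ne, a.f_ord⟩
  · rintro ⟨h1, h2⟩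
    exact ⟨⟨v.1, v.2, h1, h2⟩, rfl⟩

/-- The image of the global chart is open in `s_L × s`. -/
theorem isOpen_range_chart : IsOpen (Set.range fun a : RL => coords a.toTan) := by
  have h : (Set.range fun a : RL => coords a.toTan) =
      {y : SL × (ℕ → ℂ) | y.1 ≠ 0 ∧ y.2 0 ≠ 0} := by
    have h1 : (Set.range fun a : RL => coords a.toTan) = coords.symm ⁻¹' (Set.range toTan) := by
      ext y
      constructor
      · rintro ⟨a, rfl⟩
        exact ⟨a, (coords.symm_apply_apply _).symm⟩
      · rintro ⟨a, ha⟩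
        exact ⟨a, by simp [ha]⟩
    rw [h1, range_toTan]
    ext y
    obtain ⟨v, rfl⟩ := coords.surjective y
    have hv : PowerSeries.constantCoeff (v.2 : ℂ⟦X⟧) = 0 := by
      rw [← PowerSeries.coeff_zero_eq_constantCoeff_apply]
      exact LinearMap.mem_ker.1 v.2.2
    simp only [Set.mem_preimage, LinearEquiv.symm_apply_apply, Set.mem_ofPred_eq,
      order_eq_one_iff, hv, true_and]
    refine and_congr (not_congr ⟨fun h0 => ?_, fun h0 => ?_⟩) Iff.rfl
    · ext n
      simp [coords, h0]
    · ext n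
      exact congrFun (congrArg Subtype.val h0) n
  rw [h]
  exact (isOpen_ne.preimage continuous_fst).inter
    (isOpen_ne.preimage ((continuous_apply 0).comp continuous_snd))

/-- Extension by zero of a function on `RL` to the whole vector space.  As `RL` is open, the
extension plays no role in limits at points of `RL`. -/
noncomputable def extend (F : RL → Tan) (v : Tan) : Tan :=
  open Classical in
  if h : v.1 ≠ 0 ∧ PowerSeries.order (v.2 : ℂ⟦X⟧) = 1 then F ⟨v.1, v.2, h.1, h.2⟩ else 0

theorem extend_toTan (F : RL → Tan) (a : RL) : extend F a.toTan = F a :=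
  dif_pos ⟨a.g_ne, a.f_ord⟩

/-- The directional derivative of `F : RL → 𝓛_s(ℂ) × z 𝕏(ℂ)` at `a` in the direction `v` exists
and equals `w`: `(F (a + t v) - F a) / t → w` as `t → 0`, in the topology of `s_L × s`. -/
def HasDirDeriv (F : RL → Tan) (a : RL) (v w : Tan) : Prop :=
  Tendsto (fun t : ℂ => coords (t⁻¹ • (extend F (a.toTan + t • v) - F a)))
    (𝓝[≠] 0) (𝓝 (coords w))

/-- The tangent space at `a`: the velocities of the curves in `RL` through `a`. -/
def tangentSpace (a : RL) : Set Tan :=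
  {v | ∃ c : ℂ → RL, c 0 = a ∧
    Tendsto (fun t : ℂ => coords (t⁻¹ • ((c t).toTan - a.toTan))) (𝓝[≠] 0) (𝓝 (coords v))}

/-- A vector field `X` (through the chart, a function `RL → 𝓛_s(ℂ) × z 𝕏(ℂ)`) is left-invariant if
for all `a` the derivative of the left translation `c ↦ a * c` at `b` maps `X b` to
`X (a * b)`. -/
def IsLeftInvariant (X : RL → Tan) : Prop :=
  ∀ a b : RL, HasDirDeriv (fun c => (a * c).toTan) b (X b) (X (a * b))

/-- `Z` is the Lie bracket `[X, Y] = d_X Y - d_Y X` of the vector fields `X` and `Y`; the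
directional derivatives are required to exist. -/
def IsLieBracket (X Y Z : RL → Tan) : Prop :=
  ∀ a : RL, ∃ u w : Tan,
    HasDirDeriv Y a (X a) u ∧ HasDirDeriv X a (Y a) w ∧ Z a = u - w

end RL
end RiordanLie

open RiordanLie RiordanLie.RL

namespace RiordanLie

/-! In the chart, left translation by `a` is the restriction of a linear map `L_a (γ, κ) = (a.g · (γ
∘ a.f), κ ∘ a.f)` of the whole space. It is therefore its own derivative, and `L_(ab) = L_a L_b`
shows that the left-invariant fields are exactly the maps `a ↦ L_a v`, with value `v` at the
identity (`isLeftInvariant_iff`).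

For the bracket, `a ↦ L_a w` is differentiated at `a = (g, f)` in a direction `(d₁, d₂)`, which
gives `(d₁ · (w₁ ∘ f) + g · (w₁' ∘ f) · d₂, (w₂' ∘ f) · d₂)`. For `d = L_a v`, the term `g · (v₁ ∘
f) · (w₁ ∘ f)` is symmetric in `v` and `w` and cancels in the commutator. The rest is `L_a` of the
stated bracket, because composition with `f` is multiplicative.

The analytic core is the chain rule `hasCoeffDeriv_laurentComp` for `t ↦ g ∘ (f + t e)`. Convergence
is coefficientwise and each coefficient involves only finitely many terms of `g`, so it reduces to
differentiating integer powers of `f + t e`. -/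

/-! ### Lower bounds of supports and linearity of composition. -/

theorem exists_eq_single_mul_coe {g : ℂ⸨X⸩} {N : ℤ} (h : ∀ n < N, g.coeff n = 0) :
    ∃ p : ℂ⟦X⟧, g = HahnSeries.single N 1 * (p : ℂ⸨X⸩) := by
  refine ⟨PowerSeries.mk fun i => g.coeff (N + i), ?_⟩
  ext k
  rw [coeff_single_mul_coe]
  split_ifs with hk
  · rw [PowerSeries.coeff_mk]
    congr 1
    omega
  · exact h k (by omega)

theorem coeff_eq_zero_of_lt_order' (g : ℂ⸨X⸩) : ∀ n < g.order, g.coeff n = 0 :=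
  fun _ => HahnSeries.coeff_eq_zero_of_lt_order

theorem coeff_coe_of_neg (p : ℂ⟦X⟧) : ∀ n < (0 : ℤ), (p : ℂ⸨X⸩).coeff n = 0 := by
  intro n hn
  rw [PowerSeries.coeff_coe, if_pos hn]

theorem coeff_coe_natCast (p : ℂ⟦X⟧) (n : ℕ) :
    (p : ℂ⸨X⸩).coeff (n : ℤ) = PowerSeries.coeff n p := by
  rw [PowerSeries.coeff_coe, if_neg (by omega), Int.natAbs_natCast]

/-- The range of summation depends only on the bounds `N` and `M`, not on the supports, so one
finite sum serves a whole family of series. -/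
theorem coeff_mul_eq_sum_Icc {g h : ℂ⸨X⸩} {N M : ℤ} (hg : ∀ n < N, g.coeff n = 0)
    (hh : ∀ n < M, h.coeff n = 0) (k : ℤ) :
    (g * h).coeff k = ∑ i ∈ Finset.Icc N (k - M), g.coeff i * h.coeff (k - i) := by
  rw [HahnSeries.coeff_mul]
  refine Finset.sum_of_injOn Prod.fst ?_ ?_ ?_ ?_
  · rintro ⟨a, b⟩ h1 ⟨c, d⟩ h2 hac
    simp only [Finset.mem_coe, Finset.mem_antidiagonal] at h1 h2 hac
    ext <;> simp <;> omega
  · rintro ⟨a, b⟩ h1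
    simp only [Finset.mem_coe, Finset.mem_antidiagonal, HahnSeries.mem_support] at h1
    simp only [Finset.coe_Icc, Set.mem_Icc]
    have h2 : N ≤ a := not_lt.1 fun h => h1.1 (hg a h)
    have h3 : M ≤ b := not_lt.1 fun h => h1.2.1 (hh b h)
    omega
  · intro i _ hi
    by_contra hne
    apply hi
    refine ⟨(i, k - i), ?_, rfl⟩
    simp only [Finset.mem_coe, Finset.mem_antidiagonal, HahnSeries.mem_support]
    exact ⟨left_ne_zero_of_mul hne, right_ne_zero_of_mul hne, by ring⟩
  · rintro ⟨a, b⟩ h1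
    simp only [Finset.mem_antidiagonal] at h1
    simp [← h1.2.2]

theorem coeff_mul_eq_zero {g h : ℂ⸨X⸩} {N M : ℤ} (hg : ∀ n < N, g.coeff n = 0)
    (hh : ∀ n < M, h.coeff n = 0) : ∀ k < N + M, (g * h).coeff k = 0 := by
  intro k hk
  rw [coeff_mul_eq_sum_Icc hg hh, Finset.Icc_eq_empty (by omega), Finset.sum_empty]

theorem coeff_laurentComp_eq_zero {f : ℂ⟦X⟧} (hf : f.order = 1) {g : ℂ⸨X⸩} {N : ℤ}
    (hg : ∀ n < N, g.coeff n = 0) : ∀ n < N, (laurentComp g f).coeff n = 0 := by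
  obtain ⟨p, rfl⟩ := exists_eq_single_mul_coe hg
  obtain ⟨w, hw⟩ := coe_zpow_eq hf N
  intro n hn
  rw [laurentComp_single_mul hf, hw, mul_assoc, ← map_mul, coeff_single_mul_coe,
    if_neg (by omega)]

theorem laurentComp_add {f : ℂ⟦X⟧} (hf : f.order = 1) (g h : ℂ⸨X⸩) :
    laurentComp (g + h) f = laurentComp g f + laurentComp h f := by
  -- A common lower bound lets both series be factored by the same power of `z`, which reduces
  -- additivity to that of power series substitution.
  obtain ⟨p, hp⟩ := exists_eq_single_mul_coe (g := g) (N := min g.order h.order)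
    fun n hn => coeff_eq_zero_of_lt_order' g n (by omega)
  obtain ⟨q, hq⟩ := exists_eq_single_mul_coe (g := h) (N := min g.order h.order)
    fun n hn => coeff_eq_zero_of_lt_order' h n (by omega)
  generalize min g.order h.order = N at hp hq
  rw [hp, hq, ← mul_add, ← map_add, laurentComp_single_mul hf, laurentComp_single_mul hf,
    laurentComp_single_mul hf, PowerSeries.subst_add (hasSubst_of_order hf), map_add, mul_add]

theorem laurentComp_C {f : ℂ⟦X⟧} (hf : f.order = 1) (c : ℂ) :
    laurentComp (HahnSeries.C c) f = HahnSeries.C c := by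
  rw [← PowerSeries.coe_C, laurentComp_coe hf]
  congr 1
  have h : (PowerSeries.C c : ℂ⟦X⟧) = algebraMap ℂ ℂ⟦X⟧ c := rfl
  rw [h, ← PowerSeries.coe_substAlgHom (hasSubst_of_order hf), AlgHom.commutes]

theorem laurentComp_smul {f : ℂ⟦X⟧} (hf : f.order = 1) (c : ℂ) (g : ℂ⸨X⸩) :
    laurentComp (c • g) f = c • laurentComp g f := by
  rw [← HahnSeries.C_mul_eq_smul, laurentComp_mul hf, laurentComp_C hf, HahnSeries.C_mul_eq_smul]

/-- Composition with a series of order one as a linear map. -/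
noncomputable def laurentCompLin {f : ℂ⟦X⟧} (hf : f.order = 1) : ℂ⸨X⸩ →ₗ[ℂ] ℂ⸨X⸩ where
  toFun g := laurentComp g f
  map_add' := laurentComp_add hf
  map_smul' := laurentComp_smul hf

theorem laurentComp_single {f : ℂ⟦X⟧} (hf : f.order = 1) (n : ℤ) :
    laurentComp (HahnSeries.single n 1) f = (f : ℂ⸨X⸩) ^ n := by
  have h := laurentComp_single_mul hf n 1
  rw [← laurentComp_coe hf, RingHom.map_one, laurentComp_one hf] at h
  rwa [mul_one, mul_one] at h

-- The formal derivative of Laurent series.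

local notation "δ" => LaurentSeries.derivative (V := ℂ) ℂ

theorem coeff_laurentDerivative (g : ℂ⸨X⸩) (n : ℤ) :
    (δ g).coeff n = ((n : ℂ) + 1) * g.coeff (n + 1) := by
  rw [LaurentSeries.derivative_apply, LaurentSeries.hasseDeriv_coeff, Nat.cast_one,
    Ring.choose_one_right, zsmul_eq_mul]
  push_cast
  rfl

theorem laurentDerivative_coe (p : ℂ⟦X⟧) :
    δ (p : ℂ⸨X⸩) = (PowerSeries.derivative ℂ p : ℂ⟦X⟧) := by
  ext n
  rw [coeff_laurentDerivative]
  rcases lt_or_ge n 0 with hn | hn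
  · rw [coeff_coe_of_neg _ n hn]
    -- At `n = -1` the constant term of `p` appears, and it is the factor `n + 1` that vanishes.
    rcases eq_or_ne n (-1) with rfl | h
    · simp
    · rw [coeff_coe_of_neg _ (n + 1) (by omega), mul_zero]
  · lift n to ℕ using hn
    rw [coeff_coe_natCast, PowerSeries.coeff_derivative, ← Nat.cast_succ, coeff_coe_natCast]
    push_cast
    ring

theorem laurentDerivative_single (n : ℤ) :
    δ (HahnSeries.single n 1) = HahnSeries.single (n - 1) (n : ℂ) := by
  rw [LaurentSeries.derivative_apply, LaurentSeries.hasseDeriv_single, Nat.cast_one,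
    Ring.choose_one_right, zsmul_eq_mul, mul_one]

theorem laurentDerivative_single_mul (n : ℤ) (g : ℂ⸨X⸩) :
    δ (HahnSeries.single n 1 * g) =
      HahnSeries.single (n - 1) (n : ℂ) * g + HahnSeries.single n 1 * δ g := by
  ext k
  rw [coeff_laurentDerivative, HahnSeries.coeff_add]
  have e1 : k + 1 = (k + 1 - n) + n := by ring
  have e2 : k = (k + 1 - n) + (n - 1) := by ring
  have e3 : k = (k - n) + n := by ring
  conv_lhs => rw [e1, HahnSeries.coeff_single_mul_add]
  conv_rhs => lhs; rw [e2, HahnSeries.coeff_single_mul_add]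
  conv_rhs => rhs; rw [e3, HahnSeries.coeff_single_mul_add]
  rw [coeff_laurentDerivative, show k - n + 1 = k + 1 - n by ring]
  push_cast
  ring

/-- Factoring out powers of `z` reduces this to the Leibniz rule for power series and the derivative
of a monomial. -/
theorem laurentDerivative_mul (g h : ℂ⸨X⸩) : δ (g * h) = δ g * h + g * δ h := by
  obtain ⟨p, hp⟩ := exists_eq_single_mul_coe (coeff_eq_zero_of_lt_order' g)
  obtain ⟨q, hq⟩ := exists_eq_single_mul_coe (coeff_eq_zero_of_lt_order' h)
  generalize g.order = m at hp
  generalize h.order = n at hq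
  subst hp hq
  have hs (a b : ℤ) (c : ℂ) : HahnSeries.single (a + b) c =
      HahnSeries.single a c * HahnSeries.single b (1 : ℂ) := by
    rw [HahnSeries.single_mul_single, mul_one]
  have hs' (a : ℤ) (c : ℂ) : HahnSeries.single a c =
      HahnSeries.C c * HahnSeries.single a (1 : ℂ) := by
    rw [HahnSeries.C_apply, HahnSeries.single_mul_single, zero_add, mul_one]
  rw [mul_mul_mul_comm, HahnSeries.single_mul_single, one_mul, ← map_mul,
    laurentDerivative_single_mul, laurentDerivative_single_mul, laurentDerivative_single_mul,
    laurentDerivative_coe, laurentDerivative_coe, laurentDerivative_coe, Derivation.leibniz]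
  -- Every monomial is split into a constant and powers with exponents `m`, `n` and `-1`, the atoms
  -- in which `ring` can compare both sides.
  rw [show m + n - 1 = m + n + (-1) by ring, show m - 1 = m + (-1) by ring,
    show n - 1 = n + (-1) by ring, hs' (m + n + (-1)), hs' (m + (-1)), hs' (n + (-1)),
    hs (m + n), hs m (-1), hs n (-1), hs m n]
  simp only [Int.cast_add, map_add, smul_eq_mul, map_mul]
  ring

end RiordanLie
-- Coefficientwise differentiation of families of Laurent series.
namespace RiordanLie

/-- The family `A` of Laurent series has uniformly bounded below supports near `0`, and its
coefficients have the coefficients of `A'` as derivatives at `0`. -/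
def HasCoeffDeriv (A : ℂ → ℂ⸨X⸩) (A' : ℂ⸨X⸩) : Prop :=
  (∃ N : ℤ, ∀ᶠ t in 𝓝 (0 : ℂ), ∀ n < N, (A t).coeff n = 0) ∧
    ∀ n : ℤ, HasDerivAt (fun t => (A t).coeff n) (A'.coeff n) 0

namespace HasCoeffDeriv

variable {A B : ℂ → ℂ⸨X⸩} {A' B' : ℂ⸨X⸩}

theorem congr (hA : HasCoeffDeriv A A') (h : ∀ᶠ t in 𝓝 0, B t = A t) : HasCoeffDeriv B A' := by
  obtain ⟨⟨N, hN⟩, hA⟩ := hA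
  refine ⟨⟨N, ?_⟩, fun n => (hA n).congr_of_eventuallyEq ?_⟩
  · filter_upwards [hN, h] with t h1 h2
    rwa [h2]
  · filter_upwards [h] with t h2
    rw [h2]

theorem unique (hA : HasCoeffDeriv A A') (hB : HasCoeffDeriv A B') : A' = B' := by
  ext n
  exact (hA.2 n).unique (hB.2 n)

theorem const (g : ℂ⸨X⸩) : HasCoeffDeriv (fun _ => g) 0 :=
  ⟨⟨g.order, Eventually.of_forall fun _ => coeff_eq_zero_of_lt_order' g⟩,
    fun n => hasDerivAt_const (0 : ℂ) (g.coeff n)⟩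

theorem line (g d : ℂ⸨X⸩) : HasCoeffDeriv (fun t => g + t • d) d := by
  refine ⟨⟨min g.order d.order, Eventually.of_forall fun t n hn => ?_⟩, fun n => ?_⟩
  · rw [HahnSeries.coeff_add, HahnSeries.coeff_smul,
      coeff_eq_zero_of_lt_order' g n (by omega), coeff_eq_zero_of_lt_order' d n (by omega),
      smul_zero, add_zero]
  · simp only [HahnSeries.coeff_add, HahnSeries.coeff_smul, smul_eq_mul]
    simpa using ((hasDerivAt_id (0 : ℂ)).mul_const (d.coeff n)).const_add (g.coeff n)

theorem coeff_eq_zero {N : ℤ} (hA : HasCoeffDeriv A A')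
    (hN : ∀ᶠ t in 𝓝 (0 : ℂ), ∀ n < N, (A t).coeff n = 0) : ∀ n < N, A'.coeff n = 0 := by
  intro n hn
  refine (hA.2 n).unique ((hasDerivAt_const (0 : ℂ) (0 : ℂ)).congr_of_eventuallyEq ?_)
  filter_upwards [hN] with t h
  exact h n hn

/-- The uniform lower bounds make each coefficient of the product a sum over an index set
independent of `t`, which is differentiated term by term. -/
theorem mul (hA : HasCoeffDeriv A A') (hB : HasCoeffDeriv B B') :
    HasCoeffDeriv (fun t => A t * B t) (A' * B 0 + A 0 * B') := by
  obtain ⟨N, hN⟩ := hA.1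
  obtain ⟨M, hM⟩ := hB.1
  refine ⟨⟨N + M, ?_⟩, fun k => ?_⟩
  · filter_upwards [hN, hM] with t h1 h2
    exact coeff_mul_eq_zero h1 h2
  · rw [HahnSeries.coeff_add, coeff_mul_eq_sum_Icc (hA.coeff_eq_zero hN) hM.self_of_nhds,
      coeff_mul_eq_sum_Icc hN.self_of_nhds (hB.coeff_eq_zero hM), ← Finset.sum_add_distrib]
    refine (HasDerivAt.fun_sum fun i _ => (hA.2 i).mul (hB.2 (k - i))).congr_of_eventuallyEq ?_
    filter_upwards [hN, hM] with t h1 h2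
    rw [coeff_mul_eq_sum_Icc h1 h2]
    rfl

theorem pow (hA : HasCoeffDeriv A A') (m : ℕ) :
    HasCoeffDeriv (fun t => A t ^ m) ((m : ℂ⸨X⸩) * A 0 ^ (m - 1) * A') := by
  induction m with
  | zero => simpa using const 1
  | succ m ih =>
    have h := ih.mul hA
    simp only [← pow_succ] at h
    convert h using 1
    -- The truncated exponent `m - 1` from the induction hypothesis is harmless at `m = 0`, where
    -- the factor `m` vanishes.
    rcases m with _ | m
    · simp
    · simp only [Nat.add_sub_cancel]
      push_cast
      ring

end HasCoeffDeriv

/-! ### Integer powers of `f + t e` and the chain rule. -/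

theorem laurent_zero_smul (g : ℂ⸨X⸩) : (0 : ℂ) • g = 0 := by
  rw [← HahnSeries.C_mul_eq_smul, map_zero, zero_mul]

theorem coe_add_smul (f e : ℂ⟦X⟧) (t : ℂ) :
    ((f + t • e : ℂ⟦X⟧) : ℂ⸨X⸩) = (f : ℂ⸨X⸩) + t • (e : ℂ⸨X⸩) := by
  rw [map_add, PowerSeries.smul_eq_C_mul, map_mul, PowerSeries.coe_C, HahnSeries.C_mul_eq_smul]

theorem eventually_order_add_smul {f e : ℂ⟦X⟧} (hf : f.order = 1)
    (he : PowerSeries.constantCoeff e = 0) : ∀ᶠ t in 𝓝 (0 : ℂ), (f + t • e).order = 1 := by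
  obtain ⟨h0, h1⟩ := ord_one_data hf
  have hc : Tendsto (fun t : ℂ => PowerSeries.coeff 1 f + t * PowerSeries.coeff 1 e) (𝓝 0)
      (𝓝 (PowerSeries.coeff 1 f + 0 * PowerSeries.coeff 1 e)) :=
    Continuous.tendsto (by fun_prop) 0
  rw [zero_mul, add_zero] at hc
  filter_upwards [hc.eventually_ne h1] with t ht
  rw [order_eq_one_iff]
  refine ⟨?_, ?_⟩
  · rw [map_add, ← PowerSeries.coeff_zero_eq_constantCoeff_apply (t • e), map_smul,
      PowerSeries.coeff_zero_eq_constantCoeff_apply, h0, he, smul_zero, add_zero]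
  · rwa [map_add, map_smul, smul_eq_mul]

theorem coe_inv {u : ℂ⟦X⟧} (hu : PowerSeries.constantCoeff u ≠ 0) :
    ((u⁻¹ : ℂ⟦X⟧) : ℂ⸨X⸩) = (u : ℂ⸨X⸩)⁻¹ := by
  refine eq_inv_of_mul_eq_one_right ?_
  rw [← map_mul, PowerSeries.mul_inv_cancel _ hu, map_one]

/-- The coefficients of an inverse are given recursively by earlier ones and the inverse of the
constant term. Differentiability alone suffices: the value of the derivative is found later from the
product rule. -/
theorem differentiableAt_coeff_inv {u : ℂ → ℂ⟦X⟧}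
    (hu : ∀ n, DifferentiableAt ℂ (fun t => PowerSeries.coeff n (u t)) 0)
    (h0 : PowerSeries.constantCoeff (u 0) ≠ 0) (n : ℕ) :
    DifferentiableAt ℂ (fun t => PowerSeries.coeff n (u t)⁻¹) 0 := by
  have hc : DifferentiableAt ℂ (fun t => (PowerSeries.constantCoeff (u t))⁻¹) 0 := by
    have := hu 0
    simp only [PowerSeries.coeff_zero_eq_constantCoeff_apply] at this
    exact this.inv h0
  induction n using Nat.strong_induction_on with
  | _ n ih =>
    rw [funext fun t => PowerSeries.coeff_inv n (u t)]
    rcases eq_or_ne n 0 with rfl | hn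
    · simpa using hc
    · simp only [if_neg hn]
      refine hc.neg.mul (DifferentiableAt.fun_sum fun x _ => ?_)
      by_cases hx : x.2 < n
      · simp only [if_pos hx]
        exact (hu _).mul (ih _ hx)
      · simp only [if_neg hx]
        exact differentiableAt_const _

theorem exists_hasCoeffDeriv_coe {u : ℂ → ℂ⟦X⟧}
    (hu : ∀ n, DifferentiableAt ℂ (fun t => PowerSeries.coeff n (u t)) 0) :
    ∃ D, HasCoeffDeriv (fun t => (u t : ℂ⸨X⸩)) D := by
  refine ⟨((PowerSeries.mk fun n => deriv (fun t => PowerSeries.coeff n (u t)) 0 : ℂ⟦X⟧) : ℂ⸨X⸩),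
    ⟨0, Eventually.of_forall fun t => coeff_coe_of_neg _⟩, fun n => ?_⟩
  rcases lt_or_ge n 0 with hn | hn
  · simp only [coeff_coe_of_neg _ n hn]
    exact hasDerivAt_const _ _
  · lift n to ℕ using hn
    simp only [coeff_coe_natCast, PowerSeries.coeff_mk]
    exact (hu n).hasDerivAt

theorem exists_eq_X_mul {f : ℂ⟦X⟧} (hf : PowerSeries.constantCoeff f = 0) :
    ∃ u : ℂ⟦X⟧, f = PowerSeries.X * u :=
  PowerSeries.X_dvd_iff.2 hf

/-- Existence comes from `f + t e = z (u + t v)` with `u + t v` invertible near `t = 0`. The value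
then follows by differentiating `(f + t e)⁻¹ (f + t e) = 1`. -/
theorem hasCoeffDeriv_inv_line {f e : ℂ⟦X⟧} (hf : f.order = 1)
    (he : PowerSeries.constantCoeff e = 0) :
    HasCoeffDeriv (fun t => ((f + t • e : ℂ⟦X⟧) : ℂ⸨X⸩)⁻¹)
      (-((f : ℂ⸨X⸩)⁻¹ * (f : ℂ⸨X⸩)⁻¹ * (e : ℂ⸨X⸩))) := by
  obtain ⟨u, hu⟩ := exists_eq_X_mul (ord_one_data hf).1
  obtain ⟨v, hv⟩ := exists_eq_X_mul he
  have hu0 : PowerSeries.constantCoeff u ≠ 0 := by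
    have h := (ord_one_data hf).2
    rwa [hu, ← zero_add 1, PowerSeries.coeff_succ_X_mul,
      PowerSeries.coeff_zero_eq_constantCoeff_apply] at h
  have hd : ∀ n, DifferentiableAt ℂ (fun t : ℂ => PowerSeries.coeff n (u + t • v)) 0 := by
    intro n
    simp only [map_add, map_smul, smul_eq_mul]
    fun_prop
  obtain ⟨D, hD⟩ := exists_hasCoeffDeriv_coe
    (differentiableAt_coeff_inv hd (by simpa using hu0))
  have hne : ∀ᶠ t in 𝓝 (0 : ℂ), PowerSeries.constantCoeff (u + t • v) ≠ 0 := by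
    have h := (hd 0).continuousAt.eventually_ne (y := 0) (by simpa using hu0)
    simpa only [PowerSeries.coeff_zero_eq_constantCoeff_apply] using h
  obtain ⟨D', h1⟩ : ∃ D', HasCoeffDeriv (fun t => ((f + t • e : ℂ⟦X⟧) : ℂ⸨X⸩)⁻¹) D' := by
    refine ⟨_, ((HasCoeffDeriv.const ((PowerSeries.X : ℂ⟦X⟧) : ℂ⸨X⸩)⁻¹).mul hD).congr ?_⟩
    filter_upwards [hne] with t ht
    rw [hu, hv, ← mul_smul_comm, ← mul_add, map_mul, mul_inv, coe_inv ht]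
  have h2 := h1.mul (HasCoeffDeriv.line (f : ℂ⸨X⸩) (e : ℂ⸨X⸩))
  have h3 := (HasCoeffDeriv.const 1).congr (B := fun t => ((f + t • e : ℂ⟦X⟧) : ℂ⸨X⸩)⁻¹ *
      ((f : ℂ⸨X⸩) + t • (e : ℂ⸨X⸩))) (by
    filter_upwards [eventually_order_add_smul hf he] with t ht
    rw [← coe_add_smul, inv_mul_cancel₀ (coe_ne_zero ht)])
  have h4 := h2.unique h3
  simp only [← coe_add_smul, zero_smul, add_zero] at h4
  have hf0 := coe_ne_zero hf
  convert h1 using 1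
  apply mul_right_cancel₀ hf0
  rw [eq_neg_of_add_eq_zero_left h4]
  field_simp

theorem hasCoeffDeriv_zpow_line {f e : ℂ⟦X⟧} (hf : f.order = 1)
    (he : PowerSeries.constantCoeff e = 0) (n : ℤ) :
    HasCoeffDeriv (fun t => ((f + t • e : ℂ⟦X⟧) : ℂ⸨X⸩) ^ n)
      ((n : ℂ) • ((f : ℂ⸨X⸩) ^ (n - 1) * (e : ℂ⸨X⸩))) := by
  have hf0 := coe_ne_zero hf
  rcases n with m | m
  · have h := (HasCoeffDeriv.line (f : ℂ⸨X⸩) (e : ℂ⸨X⸩)).pow m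
    simp only [← coe_add_smul] at h
    simp only [Int.ofNat_eq_natCast, zpow_natCast]
    convert h using 1
    simp only [zero_smul, add_zero]
    rcases m with _ | m
    · simp
    · simp only [Nat.add_sub_cancel]
      rw [← HahnSeries.C_mul_eq_smul]
      push_cast
      rw [add_sub_cancel_right, zpow_natCast, map_add, map_natCast, map_one]
      ring
  · have h := (hasCoeffDeriv_inv_line hf he).pow (m + 1)
    simp only [inv_pow, ← zpow_negSucc] at h
    convert h using 1
    simp only [zero_smul, add_zero, Nat.add_sub_cancel]
    rw [← HahnSeries.C_mul_eq_smul, show Int.negSucc m - 1 = -((m + 2 : ℕ) : ℤ) by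
      rw [Int.negSucc_eq]; push_cast; ring, zpow_neg, zpow_natCast, Int.cast_negSucc, map_neg,
      map_natCast]
    field_simp
    push_cast
    ring

theorem laurent_smul_mul (c : ℂ) (g h : ℂ⸨X⸩) : c • g * h = c • (g * h) := by
  rw [← HahnSeries.C_mul_eq_smul, ← HahnSeries.C_mul_eq_smul, mul_assoc]

theorem exists_eq_sum_single_add {g : ℂ⸨X⸩} {N : ℤ} (hg : ∀ n < N, g.coeff n = 0) (K : ℤ) :
    ∃ r : ℂ⸨X⸩, (∀ n < K + 1, r.coeff n = 0) ∧
      g = ∑ n ∈ Finset.Icc N K, g.coeff n • HahnSeries.single n (1 : ℂ) + r := by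
  refine ⟨g - ∑ n ∈ Finset.Icc N K, g.coeff n • HahnSeries.single n (1 : ℂ), fun n hn => ?_,
    (add_sub_cancel _ _).symm⟩
  rw [HahnSeries.coeff_sub, HahnSeries.coeff_sum]
  simp only [HahnSeries.coeff_smul, HahnSeries.coeff_single, smul_eq_mul, mul_ite, mul_one,
    mul_zero, Finset.sum_ite_eq, Finset.mem_Icc]
  split_ifs with h
  · exact sub_self _
  · rw [hg n (by omega), sub_zero]

/-- This is the chain rule. Composition with a series of order one does not lower the support bound,
so a fixed coefficient sees only a finite truncation of `g`, and linearity reduces to monomials. -/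
theorem hasCoeffDeriv_laurentComp {f e : ℂ⟦X⟧} (hf : f.order = 1)
    (he : PowerSeries.constantCoeff e = 0) (g : ℂ⸨X⸩) :
    HasCoeffDeriv (fun t => laurentComp g (f + t • e))
      (laurentComp (LaurentSeries.derivative ℂ g) f * (e : ℂ⸨X⸩)) := by
  have hord := eventually_order_add_smul hf he
  refine ⟨⟨g.order, ?_⟩, fun k => ?_⟩
  · filter_upwards [hord] with t ht
    exact coeff_laurentComp_eq_zero ht (coeff_eq_zero_of_lt_order' g)
  -- The cut-off is `k + 1` and not `k` because differentiation lowers indices by one: `r` starts at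
  -- `k + 2`, so its derivative starts at `k + 1` and still misses index `k`, using only that `e`
  -- has no negative powers.
  · obtain ⟨r, hr, hgr⟩ := exists_eq_sum_single_add (coeff_eq_zero_of_lt_order' g) (k + 1)
    have hr' : ∀ n < k + 1, (LaurentSeries.derivative ℂ r).coeff n = 0 := by
      intro n hn
      rw [coeff_laurentDerivative, hr _ (by omega), mul_zero]
    have h1 : (laurentComp (LaurentSeries.derivative ℂ g) f * (e : ℂ⸨X⸩)).coeff k =
        ∑ n ∈ Finset.Icc g.order (k + 1),
          g.coeff n * ((n : ℂ) • ((f : ℂ⸨X⸩) ^ (n - 1) * (e : ℂ⸨X⸩))).coeff k := by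
      conv_lhs => rw [hgr]
      rw [map_add, laurentComp_add hf, add_mul, HahnSeries.coeff_add,
        coeff_mul_eq_zero (coeff_laurentComp_eq_zero hf hr') (coeff_coe_of_neg e) k (by omega),
        add_zero, map_sum]
      change (laurentCompLin hf _ * _).coeff k = _
      rw [map_sum, Finset.sum_mul, HahnSeries.coeff_sum]
      refine Finset.sum_congr rfl fun n _ => ?_
      rw [map_smul, map_smul, laurentDerivative_single, laurent_smul_mul, HahnSeries.coeff_smul,
        smul_eq_mul]
      congr 2
      rw [← laurent_smul_mul, ← laurentComp_single hf (n - 1), ← laurentComp_smul hf,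
        ← HahnSeries.C_mul_eq_smul, HahnSeries.C_apply, HahnSeries.single_mul_single, zero_add,
        mul_one]
      rfl
    rw [h1]
    refine (HasDerivAt.fun_sum fun n _ =>
      ((hasCoeffDeriv_zpow_line hf he n).2 k).const_mul (g.coeff n)).congr_of_eventuallyEq ?_
    filter_upwards [hord] with t ht
    conv_lhs => rw [hgr]
    rw [laurentComp_add ht, HahnSeries.coeff_add, coeff_laurentComp_eq_zero ht hr k (by omega),
      add_zero]
    change (laurentCompLin ht _).coeff k = _
    rw [map_sum, HahnSeries.coeff_sum]
    refine Finset.sum_congr rfl fun n _ => ?_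
    rw [map_smul, HahnSeries.coeff_smul, smul_eq_mul]
    congr 2
    exact laurentComp_single ht n

end RiordanLie
-- Coordinates and the tangent space.
namespace RiordanLie
namespace RL

theorem mem_ZX {p : ℂ⟦X⟧} : p ∈ ZX ↔ PowerSeries.constantCoeff p = 0 := by
  rw [ZX, LinearMap.mem_ker, PowerSeries.coeff_zero_eq_constantCoeff_apply]

theorem tendsto_coords_iff {l : Filter ℂ} {G : ℂ → Tan} {w : Tan} :
    Tendsto (fun t => coords (G t)) l (𝓝 (coords w)) ↔
      (∀ n : ℤ, Tendsto (fun t => (G t).1.coeff n) l (𝓝 (w.1.coeff n))) ∧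
      ∀ n : ℕ, Tendsto (fun t => PowerSeries.coeff (n + 1) ((G t).2 : ℂ⟦X⟧)) l
        (𝓝 (PowerSeries.coeff (n + 1) (w.2 : ℂ⟦X⟧))) := by
  rw [Prod.tendsto_iff, tendsto_subtype_rng, tendsto_pi_nhds, tendsto_pi_nhds]
  rfl

theorem coords_tendsto_unique {G : ℂ → Tan} {v w : Tan}
    (hv : Tendsto (fun t => coords (G t)) (𝓝[≠] 0) (𝓝 (coords v)))
    (hw : Tendsto (fun t => coords (G t)) (𝓝[≠] 0) (𝓝 (coords w))) : v = w :=
  coords.injective (tendsto_nhds_unique hv hw)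

/-- For small `t` the leading coefficient of `a.g` is perturbed to a nonzero number, and so is the
linear coefficient of `a.f`. -/
theorem eventually_mem_range_toTan (a : RL) (v : Tan) :
    ∀ᶠ t in 𝓝 (0 : ℂ), (a.toTan + t • v).1 ≠ 0 ∧
      PowerSeries.order ((a.toTan + t • v).2 : ℂ⟦X⟧) = 1 := by
  refine Eventually.and ?_ (eventually_order_add_smul a.f_ord (mem_ZX.1 v.2.2))
  have h := ((HasCoeffDeriv.line a.g v.1).2 a.g.order).continuousAt.eventually_ne (y := 0) (by
    simp only [laurent_zero_smul, add_zero]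
    exact HahnSeries.coeff_order_eq_zero.not.2 a.g_ne)
  filter_upwards [h] with t ht h0
  exact ht (by
    change (a.toTan + t • v).1.coeff _ = 0
    rw [h0, HahnSeries.coeff_zero])

theorem tangentSpace_eq_univ (a : RL) : tangentSpace a = Set.univ := by
  refine Set.eq_univ_of_forall fun v => ?_
  classical
  have h0 := (eventually_mem_range_toTan a v).self_of_nhds
  -- The curve is the straight line with velocity `v`; the fallback `a` is taken only away from `t =
  -- 0`.
  refine ⟨fun t => if h : (a.toTan + t • v).1 ≠ 0 ∧
      PowerSeries.order ((a.toTan + t • v).2 : ℂ⟦X⟧) = 1 then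
    ⟨(a.toTan + t • v).1, (a.toTan + t • v).2, h.1, h.2⟩ else a, ?_, ?_⟩
  · refine (dif_pos h0).trans ?_
    apply toTan_injective
    refine Prod.ext ?_ (Subtype.ext ?_)
    · change a.g + (0 : ℂ) • v.1 = _
      rw [laurent_zero_smul, add_zero]
      rfl
    · change a.f + (0 : ℂ) • (v.2 : ℂ⟦X⟧) = _
      rw [zero_smul, add_zero]
      rfl
  · refine tendsto_const_nhds.congr' ?_
    filter_upwards [(eventually_mem_range_toTan a v).filter_mono nhdsWithin_le_nhds,
      self_mem_nhdsWithin] with t ht ht0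
    rw [dif_pos ht]
    change _ = coords (t⁻¹ • (a.toTan + t • v - a.toTan))
    rw [add_sub_cancel_left, inv_smul_smul₀ ht0]

/-! ### Left translations and left-invariant fields. -/

theorem coe_subst {f k : ℂ⟦X⟧} (hf : f.order = 1) :
    ((k.subst f : ℂ⟦X⟧) : ℂ⸨X⸩) = laurentComp (k : ℂ⸨X⸩) f := (laurentComp_coe hf k).symm

theorem constantCoeff_subst_eq_zero {f k : ℂ⟦X⟧} (hf : f.order = 1)
    (hk : PowerSeries.constantCoeff k = 0) :
    PowerSeries.constantCoeff (k.subst f : ℂ⟦X⟧) = 0 := by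
  obtain ⟨u, rfl⟩ := exists_eq_X_mul hk
  have hs := hasSubst_of_order hf
  rw [PowerSeries.subst_mul hs, PowerSeries.subst_X hs, map_mul, (ord_one_data hf).1, zero_mul]

/-- The derivative of the left translation by `a`, which is (the restriction of) a linear map. -/
noncomputable def leftTranslation (a : RL) : Tan →ₗ[ℂ] Tan where
  toFun v := (a.g * laurentComp v.1 a.f,
    ⟨(v.2 : ℂ⟦X⟧).subst a.f, mem_ZX.2 (constantCoeff_subst_eq_zero a.f_ord (mem_ZX.1 v.2.2))⟩)
  map_add' v w := by
    refine Prod.ext ?_ (Subtype.ext ?_)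
    · change _ * laurentComp (v.1 + w.1) _ = _
      rw [laurentComp_add a.f_ord, mul_add]
      rfl
    · exact PowerSeries.subst_add (hasSubst_of_order a.f_ord) _ _
  map_smul' c v := by
    refine Prod.ext ?_ (Subtype.ext ?_)
    · change _ * laurentComp (c • v.1) _ = c • (_ * _)
      rw [laurentComp_smul a.f_ord, mul_comm, laurent_smul_mul, mul_comm]
    · exact PowerSeries.subst_smul (hasSubst_of_order a.f_ord) _ _

theorem leftTranslation_mul (a b : RL) (v : Tan) :
    leftTranslation (a * b) v = leftTranslation a (leftTranslation b v) := by
  refine Prod.ext ?_ (Subtype.ext ?_)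
  · change (a * b).g * laurentComp v.1 (a * b).f = a.g * laurentComp (b.g * laurentComp v.1 b.f) a.f
    rw [mul_g, mul_f, laurentComp_mul a.f_ord, laurentComp_comp a.f_ord b.f_ord, mul_assoc]
  · exact (PowerSeries.subst_comp_subst_apply (hasSubst_of_order b.f_ord)
      (hasSubst_of_order a.f_ord) _).symm

theorem leftTranslation_one (v : Tan) : leftTranslation 1 v = v := by
  refine Prod.ext ?_ (Subtype.ext (PowerSeries.X_subst _))
  change (1 : RL).g * laurentComp v.1 PowerSeries.X = v.1
  rw [one_g, laurentComp_X, one_mul]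

/-- By linearity the difference quotient is constant for small nonzero `t`. -/
theorem hasDirDeriv_leftTranslation (a b : RL) (v : Tan) :
    HasDirDeriv (fun c => (a * c).toTan) b v (leftTranslation a v) := by
  refine tendsto_const_nhds.congr' ?_
  filter_upwards [(eventually_mem_range_toTan b v).filter_mono nhdsWithin_le_nhds,
    self_mem_nhdsWithin] with t ht ht0
  rw [extend, dif_pos ht]
  change _ = coords (t⁻¹ • (leftTranslation a (b.toTan + t • v) - leftTranslation a b.toTan))
  rw [map_add, (leftTranslation a).map_smul, add_sub_cancel_left, inv_smul_smul₀ ht0]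

/-- The left-invariant vector field with a given value at the identity. -/
noncomputable def leftInvariantField : Tan →ₗ[ℂ] (RL → Tan) where
  toFun v a := leftTranslation a v
  map_add' v w := funext fun a => map_add (leftTranslation a) v w
  map_smul' c v := funext fun a => map_smul (leftTranslation a) c v

/-- Invariance at `b = 1` and uniqueness of limits already force `X a` to be the translate of `X 1`.
The converse is multiplicativity of `leftTranslation`. -/
theorem isLeftInvariant_iff (X : RL → Tan) :
    IsLeftInvariant X ↔ X ∈ LinearMap.range leftInvariantField := by
  constructor
  · intro h
    refine ⟨X 1, funext fun a => ?_⟩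
    have h1 := h a 1
    rw [mul_one] at h1
    exact coords_tendsto_unique (hasDirDeriv_leftTranslation a 1 (X 1)) h1
  · rintro ⟨v, rfl⟩ a b
    change HasDirDeriv _ b (leftTranslation b v) (leftTranslation (a * b) v)
    rw [leftTranslation_mul]
    exact hasDirDeriv_leftTranslation a b _

/-! ### Derivatives of left-invariant fields. -/

/-- The derivative of the vector field `leftInvariantField w` at `a` in the direction `d`. -/
noncomputable def fieldDeriv (w : Tan) (a : RL) (d : Tan) : Tan :=
  (d.1 * laurentComp w.1 a.f +
      a.g * (laurentComp (LaurentSeries.derivative ℂ w.1) a.f * ((d.2 : ℂ⟦X⟧) : ℂ⸨X⸩)),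
    ⟨(PowerSeries.derivative ℂ (w.2 : ℂ⟦X⟧)).subst a.f * (d.2 : ℂ⟦X⟧), mem_ZX.2 (by
      rw [map_mul, mem_ZX.1 d.2.2, mul_zero])⟩)

theorem hasDirDeriv_leftInvariantField (w : Tan) (a : RL) (d : Tan) :
    HasDirDeriv (leftInvariantField w) a d (fieldDeriv w a d) := by
  have he := mem_ZX.1 d.2.2
  -- The first equation has content only in the first component. The second component is read as a
  -- Laurent series, so the same chain rule serves both.
  have hev : ∀ᶠ t in 𝓝[≠] (0 : ℂ), extend (leftInvariantField w) (a.toTan + t • d) =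
      ((a.g + t • d.1) * laurentComp w.1 (a.f + t • (d.2 : ℂ⟦X⟧)),
        (extend (leftInvariantField w) (a.toTan + t • d)).2) ∧
      (((extend (leftInvariantField w) (a.toTan + t • d)).2 : ℂ⟦X⟧) : ℂ⸨X⸩) =
        laurentComp ((w.2 : ℂ⟦X⟧) : ℂ⸨X⸩) (a.f + t • (d.2 : ℂ⟦X⟧)) := by
    filter_upwards [(eventually_mem_range_toTan a d).filter_mono nhdsWithin_le_nhds] with t ht
    rw [extend, dif_pos ht]
    exact ⟨rfl, coe_subst ht.2⟩
  rw [HasDirDeriv, tendsto_coords_iff]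
  constructor
  · intro n
    have h := (((HasCoeffDeriv.line a.g d.1).mul
      (hasCoeffDeriv_laurentComp a.f_ord he w.1)).2 n).tendsto_slope_zero
    simp only [laurent_zero_smul, zero_smul, add_zero, zero_add] at h
    refine h.congr' ?_
    filter_upwards [hev] with t ht
    rw [ht.1]
    rfl
  · intro n
    have h := ((hasCoeffDeriv_laurentComp a.f_ord he ((w.2 : ℂ⟦X⟧) : ℂ⸨X⸩)).2
      ((n + 1 : ℕ) : ℤ)).tendsto_slope_zero
    rw [laurentDerivative_coe, ← coe_subst a.f_ord, ← map_mul, coeff_coe_natCast] at h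
    simp only [zero_smul, add_zero, zero_add] at h
    refine h.congr' ?_
    filter_upwards [hev] with t ht
    rw [← ht.2, coeff_coe_natCast, ← coe_subst a.f_ord, coeff_coe_natCast]
    rfl

/-! ### The Lie bracket. -/

/-- The Lie bracket on `𝓛_s(ℂ) × z 𝕏(ℂ)`. -/
noncomputable def bracket : Tan →ₗ[ℂ] Tan →ₗ[ℂ] Tan :=
  LinearMap.mk₂ ℂ (fun v w =>
    (LaurentSeries.derivative ℂ w.1 * ((v.2 : ℂ⟦X⟧) : ℂ⸨X⸩)
        - LaurentSeries.derivative ℂ v.1 * ((w.2 : ℂ⟦X⟧) : ℂ⸨X⸩),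
      ⟨PowerSeries.derivative ℂ (w.2 : ℂ⟦X⟧) * (v.2 : ℂ⟦X⟧)
          - PowerSeries.derivative ℂ (v.2 : ℂ⟦X⟧) * (w.2 : ℂ⟦X⟧), mem_ZX.2 (by
        rw [map_sub, map_mul, map_mul, mem_ZX.1 v.2.2, mem_ZX.1 w.2.2, mul_zero, mul_zero,
          sub_zero])⟩))
    (by
      intro u v w
      refine Prod.ext ?_ (Subtype.ext ?_)
      · simp only [Prod.fst_add, Prod.snd_add, Submodule.coe_add, map_add]
        ring
      · simp only [Prod.snd_add, Submodule.coe_add, map_add]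
        ring)
    (by
      intro c v w
      refine Prod.ext ?_ (Subtype.ext ?_)
      · simp only [Prod.smul_fst, Prod.smul_snd, Submodule.coe_smul, map_smul]
        simp only [PowerSeries.smul_eq_C_mul, map_mul, PowerSeries.coe_C, ← HahnSeries.C_mul_eq_smul]
        ring
      · simp only [Prod.smul_snd, Submodule.coe_smul, Derivation.map_smul]
        simp only [PowerSeries.smul_eq_C_mul]
        ring)
    (by
      intro u v w
      refine Prod.ext ?_ (Subtype.ext ?_)
      · simp only [Prod.fst_add, Prod.snd_add, Submodule.coe_add, map_add]
        ring
      · simp only [Prod.snd_add, Submodule.coe_add, map_add]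
        ring)
    (by
      intro c v w
      refine Prod.ext ?_ (Subtype.ext ?_)
      · simp only [Prod.smul_fst, Prod.smul_snd, Submodule.coe_smul, map_smul]
        simp only [PowerSeries.smul_eq_C_mul, map_mul, PowerSeries.coe_C, ← HahnSeries.C_mul_eq_smul]
        ring
      · simp only [Prod.smul_snd, Submodule.coe_smul, Derivation.map_smul]
        simp only [PowerSeries.smul_eq_C_mul]
        ring)

theorem bracket_fst (v w : Tan) : (bracket v w).1 =
    LaurentSeries.derivative ℂ w.1 * ((v.2 : ℂ⟦X⟧) : ℂ⸨X⸩)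
      - LaurentSeries.derivative ℂ v.1 * ((w.2 : ℂ⟦X⟧) : ℂ⸨X⸩) := rfl

theorem bracket_snd (v w : Tan) : ((bracket v w).2 : ℂ⟦X⟧) =
    PowerSeries.derivative ℂ (w.2 : ℂ⟦X⟧) * (v.2 : ℂ⟦X⟧)
      - PowerSeries.derivative ℂ (v.2 : ℂ⟦X⟧) * (w.2 : ℂ⟦X⟧) := rfl

theorem bracket_self (v : Tan) : bracket v v = 0 :=
  Prod.ext (sub_self _) (Subtype.ext (sub_self _))

/-- Once the Leibniz rule is applied, this is a polynomial identity in the series and their first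
and second derivatives. -/
theorem bracket_jacobi (u v w : Tan) :
    bracket u (bracket v w) + bracket v (bracket w u) + bracket w (bracket u v) = 0 := by
  refine Prod.ext ?_ (Subtype.ext ?_)
  · simp only [Prod.fst_add, Prod.fst_zero, bracket_fst, bracket_snd, map_sub, map_mul,
      laurentDerivative_mul, laurentDerivative_coe]
    ring
  · simp only [Prod.snd_add, Prod.snd_zero, Submodule.coe_add, Submodule.coe_zero, bracket_snd,
      map_sub, Derivation.leibniz, smul_eq_mul]
    ring

/-- The products without derivatives are symmetric in `v` and `w` and cancel; the remaining terms
are a translate because composition respects products and differences. -/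
theorem isLieBracket_leftInvariantField (v w : Tan) :
    IsLieBracket (leftInvariantField v) (leftInvariantField w)
      (leftInvariantField (bracket v w)) := by
  intro a
  refine ⟨_, _, hasDirDeriv_leftInvariantField w a _, hasDirDeriv_leftInvariantField v a _, ?_⟩
  refine Prod.ext ?_ (Subtype.ext ?_)
  -- Stating the composition through `laurentCompLin` makes `map_sub` applicable.
  · change a.g * laurentCompLin a.f_ord (bracket v w).1 =
      (a.g * laurentComp v.1 a.f * laurentComp w.1 a.f +
        a.g * (laurentComp (LaurentSeries.derivative ℂ w.1) a.f *
          (((v.2 : ℂ⟦X⟧).subst a.f : ℂ⟦X⟧) : ℂ⸨X⸩))) -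
      (a.g * laurentComp w.1 a.f * laurentComp v.1 a.f +
        a.g * (laurentComp (LaurentSeries.derivative ℂ v.1) a.f *
          (((w.2 : ℂ⟦X⟧).subst a.f : ℂ⟦X⟧) : ℂ⸨X⸩)))
    rw [bracket_fst, map_sub]
    change a.g * (laurentComp _ _ - laurentComp _ _) = _
    rw [laurentComp_mul a.f_ord, laurentComp_mul a.f_ord, coe_subst a.f_ord, coe_subst a.f_ord]
    ring
  · change PowerSeries.subst a.f ((bracket v w).2 : ℂ⟦X⟧) =
      (PowerSeries.derivative ℂ (w.2 : ℂ⟦X⟧)).subst a.f * (v.2 : ℂ⟦X⟧).subst a.f -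
      (PowerSeries.derivative ℂ (v.2 : ℂ⟦X⟧)).subst a.f * (w.2 : ℂ⟦X⟧).subst a.f
    have hs := hasSubst_of_order a.f_ord
    rw [bracket_snd, ← PowerSeries.coe_substAlgHom hs, map_sub, map_mul, map_mul]

end RL
end RiordanLie

theorem mainTheorem11 :
    (∀ a : RL, tangentSpace a = Set.univ) ∧
    ∃ (E : Tan →ₗ[ℂ] (RL → Tan)) (B : Tan →ₗ[ℂ] Tan →ₗ[ℂ] Tan),
      (∀ X : RL → Tan, IsLeftInvariant X ↔ X ∈ LinearMap.range E) ∧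
      (∀ v : Tan, E v 1 = v) ∧
      (∀ v w : Tan, IsLieBracket (E v) (E w) (E (B v w))) ∧
      (∀ v : Tan, B v v = 0) ∧
      (∀ u v w : Tan, B u (B v w) + B v (B w u) + B w (B u v) = 0) ∧
      (∀ v w : Tan,
        (B v w).1 = LaurentSeries.derivative ℂ w.1 * ((v.2 : ℂ⟦X⟧) : ℂ⸨X⸩)
          - LaurentSeries.derivative ℂ v.1 * ((w.2 : ℂ⟦X⟧) : ℂ⸨X⸩) ∧
        ((B v w).2 : ℂ⟦X⟧) = PowerSeries.derivative ℂ (w.2 : ℂ⟦X⟧) * (v.2 : ℂ⟦X⟧)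
          - PowerSeries.derivative ℂ (v.2 : ℂ⟦X⟧) * (w.2 : ℂ⟦X⟧)) := by
  exact ⟨tangentSpace_eq_univ, leftInvariantField, bracket, isLeftInvariant_iff,
    leftTranslation_one, isLieBracket_leftInvariantField, bracket_self, bracket_jacobi,
    fun v w => ⟨bracket_fst v w, bracket_snd v w⟩⟩
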